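/- A *biclique* $[X,Y]$ is a complete bipartite graph with nonempty vertex classes $X$ and $Y$ (no finiteness is assumed). A *bi-equivalence graph* is a graph each of whose connected components is a biclique. Suppose that the edge set of a biclique $G=[X,Y]$ is partitioned into the edge sets of five bi-equivalence graphs $G_1,\dots,G_5$ (the color classes). The partition is *spanning* if every vertex of $G$ is a vertex of every $G_i$, that is, it is incident with an edge of every color. In that case, for a vertex $u$ let $X_i[u]$ and $Y_i[u]$ (the *blocks* in color $i$) be the intersections of $X$ and of $Y$ with the vertex set of the connected component of $G_i$ that contains $u$. A spanning partition is an *antichain partition* if there are no $i,j\in\{1,\dots,5\}$ and no vertices $u,v$ of $G$ with $X_i[u]\subsetneq X_j[v]$ or $Y_i[u]\subsetneq Y_j[v]$. The *width* of $G_i$ is the number of its connected components. **Theorem 5.1.** If $G_1,\dots,G_5$ is an antichain partition of a biclique $[X,Y]$ into five bi-equivalence graphs, then for some $i\in\{1,\dots,5\}$ the width of $G_i$ is at most $8$. -/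

import Mathlib

namespace BicliquePartition

variable {V : Type*}

/-- `G` is the biclique `[X, Y]`: its vertex set is the disjoint union of the nonempty sets `X`
and `Y`, and its edges are exactly the pairs with one end in `X` and the other end in `Y`. -/
structure IsBiclique (G : SimpleGraph V) (X Y : Set V) : Prop where
  nonempty_left : X.Nonempty
  nonempty_right : Y.Nonempty
  union_eq : X ∪ Y = Set.univ
  bipartite : G.IsBipartiteWith X Y
  complete : G.IsCompleteBetween X Y

/-- A bi-equivalence graph: a graph all of whose components are bicliques. A colour class `H` is
given as a graph on the whole vertex set `V`; as a graph spanned by its edges it has the vertex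
set `H.support`, so only the components inside `H.support` are components of the colour class. -/
def IsBiEquivalenceGraph (H : SimpleGraph V) : Prop :=
  ∀ C : H.ConnectedComponent, C.supp ⊆ H.support →
    ∃ A B : Set C, IsBiclique C.toSimpleGraph A B

/-- The edge set of `G` is partitioned into the bi-equivalence graphs `H 0, …, H (r - 1)`. -/
structure IsBiEquivalencePartition (G : SimpleGraph V) {r : ℕ} (H : Fin r → SimpleGraph V) :
    Prop where
  le : ∀ i, H i ≤ G
  existsUnique_color : ∀ u v, G.Adj u v → ∃! i, (H i).Adj u v
  biEquivalence : ∀ i, IsBiEquivalenceGraph (H i)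

/-- A spanning partition: every vertex of `G` is a vertex of every colour class. -/
structure IsSpanningPartition (G : SimpleGraph V) {r : ℕ} (H : Fin r → SimpleGraph V) : Prop
    extends IsBiEquivalencePartition G H where
  spanning : ∀ i, (H i).support = Set.univ

/-- The part in `S` of the component of `H` that contains `u`. For a biclique `[X, Y]` and the
colour class `H i` of a spanning partition, `block X (H i) u` is the block `X_i[u]` and
`block Y (H i) u` is the block `Y_i[u]`. -/
def block (S : Set V) (H : SimpleGraph V) (u : V) : Set V :=
  S ∩ (H.connectedComponentMk u).supp

/-- An antichain partition of the biclique `G = [X, Y]`: a spanning partition in which no block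
is a proper subset of another block. -/
structure IsAntichainPartition (G : SimpleGraph V) (X Y : Set V) {r : ℕ}
    (H : Fin r → SimpleGraph V) : Prop extends IsSpanningPartition G H where
  antichain_left : ∀ i j u v, ¬ block X (H i) u ⊂ block X (H j) v
  antichain_right : ∀ i j u v, ¬ block Y (H i) u ⊂ block Y (H j) v

/-- The width of a colour class of a spanning partition: the number of its connected components
(`⊤` if there are infinitely many). -/
noncomputable def width (H : SimpleGraph V) : ℕ∞ :=
  ENat.card H.ConnectedComponent

end BicliquePartition

/-! Write Y_i[a] for the set of `b` with `col a b = i`. The antichain condition turns every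
inclusion between such sets into an equality: once shared blocks rule out all colours but c for `a`
on Y_i[u], the two blocks Y_i[u] and Y_c[a] coincide. Nearly every step is of this kind.

Suppose colour i has at least nine components. The crucial bound is `not_five_blocks`: a block of
another colour j meets at most four of them. Given five representatives in one j-block, no three
share a further block (`not_sameBlock_triple`), so a suitable vertex of the other class sees them in
the pattern p, p, q, q, r (`IsPentad`). This pattern forces each pair to share both p and q
(`sameBlock_second_left`), and then three further i-components are impossible
(`false_of_three_more`).

Now fix a vertex x. At least eight i-components avoid x, each shows x a nonempty set of the four
other colours, and each colour occurs on at most four of them. A colour forming a singleton set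
occurs nowhere else, by the antichain condition. Counting twice gives equality throughout
(`profile`): two colours on each such component, four components for each colour.

Finally, two wide colours, 0 and 1, contradict each other. Take four vertices of one 1-block in
different 0-components. From a vertex in the 0-component of the first, this 1-block shows only two
colours, so the other three vertices share a second block; then that 0-component shows one of them a
single colour instead of two (`exists_not_isWide`). -/

namespace BicliquePartition

/-- An edge colouring of a biclique by five colours in which every colour class is a spanning
bi-equivalence graph and no block is a proper subset of another. -/
structure IsBlockColoring {α β : Type*} (col : α → β → Fin 5) : Prop where
  cross : ∀ {a a' b b' i}, col a b = i → col a' b = i → col a' b' = i → col a b' = i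
  exists_right : ∀ a i, ∃ b, col a b = i
  exists_left : ∀ b i, ∃ a, col a b = i
  anti_right : ∀ {a a' i j}, (∀ b, col a b = i → col a' b = j) → ∀ b, col a' b = j → col a b = i
  anti_left : ∀ {b b' i j}, (∀ a, col a b = i → col a b' = j) → ∀ a, col a b' = j → col a b = i

/-- The two vertices lie in the same component of colour `i`. -/
def SameBlock {α β : Type*} (col : α → β → Fin 5) (i : Fin 5) (a a' : α) : Prop :=
  ∀ b, col a b = i ↔ col a' b = i

/-- The vertices of `s` lie in pairwise different components of colour `i`. -/
def BlockFree {α β : Type*} (col : α → β → Fin 5) (i : Fin 5) (s : Set α) : Prop :=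
  s.Pairwise fun a a' => ¬ SameBlock col i a a'

theorem SameBlock.symm {α β : Type*} {col : α → β → Fin 5} {i : Fin 5} {a a' : α}
    (h : SameBlock col i a a') : SameBlock col i a' a := fun b => (h b).symm

theorem SameBlock.trans {α β : Type*} {col : α → β → Fin 5} {i : Fin 5} {a a' a'' : α}
    (h : SameBlock col i a a') (h' : SameBlock col i a' a'') : SameBlock col i a a'' :=
  fun b => (h b).trans (h' b)

theorem forall_color_of_nodup {i j p q r : Fin 5} (h : [i, j, p, q, r].Nodup) (c : Fin 5) :
    c = i ∨ c = j ∨ c = p ∨ c = q ∨ c = r := by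
  have hu : [i, j, p, q, r].toFinset = Finset.univ := by
    rw [← Finset.card_eq_iff_eq_univ, List.toFinset_card_of_nodup h]
    rfl
  have := Finset.mem_univ c
  rw [← hu] at this
  simpa using this

theorem exists_nodup_of_three {i j p : Fin 5} (hij : i ≠ j) (hip : i ≠ p) (hjp : j ≠ p) :
    ∃ q r, [i, j, p, q, r].Nodup := by
  revert i j p
  decide

/-! ### Antichain consequences: vertices sharing several blocks -/

namespace IsBlockColoring

variable {α β : Type*} {col : α → β → Fin 5}

theorem swap (h : IsBlockColoring col) : IsBlockColoring fun b a => col a b where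
  cross h₁ h₂ h₃ := h.cross h₃ h₂ h₁
  exists_right := h.exists_left
  exists_left := h.exists_right
  anti_right := h.anti_left
  anti_left := h.anti_right

theorem sameBlock (h : IsBlockColoring col) {i : Fin 5} {a a' : α} {b : β} (hb : col a b = i)
    (hb' : col a' b = i) : SameBlock col i a a' :=
  fun _ => ⟨fun h₁ => h.cross hb' hb h₁, fun h₁ => h.cross hb hb' h₁⟩

theorem ne_of_sameBlock_swap {i : Fin 5} {a a' : α} {b b' : β} (ha : ¬ SameBlock col i a a')
    (h : IsBlockColoring col) (hb : col a b = i) (hb' : col a' b' = i) :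
    ¬ SameBlock (fun b a => col a b) i b b' :=
  fun hs => ha (h.sameBlock hb ((hs a').2 hb'))

/-- Sharing j, p and q leaves `a` only colour r on Y_i[b], so Y_i[b] = Y_r[a]. On Y_i[c] colour r is
then taken, so Y_i[c] = Y_q[a], which contains `y`. -/
theorem sameBlock_pair_false (h : IsBlockColoring col) {i j p q r : Fin 5}
    (hc : [i, j, p, q, r].Nodup) {a b c : α} (hj : SameBlock col j a b)
    (hj' : SameBlock col j a c) (hp : SameBlock col p a b) (hp' : SameBlock col p a c)
    (hab : ¬ SameBlock col i a b) (hac : ¬ SameBlock col i a c) (hbc : ¬ SameBlock col i b c)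
    {y : β} (hya : col a y = q) (hyb : col b y = q) (hyc : col c y ≠ i) : False := by
  have hcol := forall_color_of_nodup hc
  have hq := h.sameBlock hya hyb
  have hs : ∀ {a b : α} {y}, ¬ SameBlock col i a b → col a y = i → col b y = i → False :=
    fun hn h₁ h₂ => hn (h.sameBlock h₁ h₂)
  simp only [List.nodup_cons, List.mem_cons, List.not_mem_nil, or_false, not_or] at hc
  have hB : ∀ z, col b z = i → col a z = r := by
    intro z hz
    have := hcol (col a z); have := hs hab (y := z); have := hj z; have := hp z; have := hq z
    grind
  have hB' := h.anti_right hB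
  have hC : ∀ z, col c z = i → col a z = q := by
    intro z hz
    have := hcol (col a z); have := hs hac (y := z); have := hs hbc (y := z)
    have := hj' z; have := hp' z; have := hB' z
    grind
  exact hyc (h.anti_right hC y hya)

/-- If three vertices from different components of colour `i` have the same block in the colours
`j` and `p`, then their block in colour `p` contains all further vertices outside their block in
colour `j`. -/
theorem col_eq_of_triple (h : IsBlockColoring col) {i j p : Fin 5} (hij : i ≠ j) (hip : i ≠ p)
    (hjp : j ≠ p) {a b c : α} (hj : SameBlock col j a b)
    (hj' : SameBlock col j a c) (hp : SameBlock col p a b) (hp' : SameBlock col p a c)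
    (hab : ¬ SameBlock col i a b) (hac : ¬ SameBlock col i a c) (hbc : ¬ SameBlock col i b c)
    {y : β} (hyj : col a y ≠ j) (hya : col a y ≠ i) (hyb : col b y ≠ i) (hyc : col c y ≠ i) :
    col a y = p := by
  obtain ⟨q, r, hc⟩ := exists_nodup_of_three hij hip hjp
  have hc' : [i, j, p, r, q].Nodup := by
    simp only [List.nodup_cons, List.mem_cons, List.not_mem_nil, or_false, not_or] at hc ⊢
    grind
  by_contra hy
  -- If `a` does not have colour p at `y`, all three vertices are coloured from q, r there, so two
  -- of them agree.
  have key : ∀ {q r : Fin 5}, [i, j, p, q, r].Nodup →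
      ¬ (col a y = q ∧ col b y = q) ∧ ¬ (col a y = q ∧ col c y = q) ∧
      ¬ (col b y = q ∧ col c y = q) := by
    intro q r hc
    refine ⟨fun ⟨h₁, h₂⟩ => ?_, fun ⟨h₁, h₂⟩ => ?_, fun ⟨h₁, h₂⟩ => ?_⟩
    · exact h.sameBlock_pair_false hc hj hj' hp hp' hab hac hbc h₁ h₂ hyc
    · exact h.sameBlock_pair_false hc hj' hj hp' hp hac hab (fun hs => hbc hs.symm) h₁ h₂ hyb
    · exact h.sameBlock_pair_false hc (hj.symm.trans hj') hj.symm (hp.symm.trans hp') hp.symm hbc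
        (fun hs => hab hs.symm) (fun hs => hac hs.symm) h₁ h₂ hya
  have h₁ := key hc
  have h₂ := key hc'
  have hcol := forall_color_of_nodup hc
  have := hcol (col a y); have := hcol (col b y); have := hcol (col c y)
  have := hj y; have := hj' y; have := hp y; have := hp' y
  grind

/-- The i-blocks of `d` and of `e` would both lie in Y_p[a], hence both equal it, although they are
different. -/
theorem not_sameBlock_triple (h : IsBlockColoring col) {i j p : Fin 5} (hij : i ≠ j) (hip : i ≠ p)
    (hjp : j ≠ p) {s : Set α} (hj : ∀ a ∈ s, ∀ b ∈ s, SameBlock col j a b)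
    (hi : BlockFree col i s) {a b c d e : α} (hs : [a, b, c, d, e].Nodup)
    (ha : a ∈ s) (hb : b ∈ s) (hc : c ∈ s) (hd : d ∈ s) (he : e ∈ s) (hp : SameBlock col p a b)
    (hp' : SameBlock col p a c) : False := by
  simp only [List.nodup_cons, List.mem_cons, List.not_mem_nil, or_false, not_or] at hs
  have key : ∀ u ∈ s, u ≠ a → u ≠ b → u ≠ c → ∀ y, col a y = p → col u y = i := by
    intro u hu hua hub huc
    refine h.anti_right fun y hy => ?_
    have hne : ∀ v ∈ s, u ≠ v → col v y ≠ i := fun v hv hne hvy =>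
      hi hu hv hne (h.sameBlock hy hvy)
    refine h.col_eq_of_triple hij hip hjp (hj a ha b hb) (hj a ha c hc) hp hp'
      (hi ha hb (by grind)) (hi ha hc (by grind)) (hi hb hc (by grind)) ?_
      (hne a ha hua) (hne b hb hub) (hne c hc huc)
    intro hyj
    exact hij (hy.symm.trans ((hj a ha u hu y).1 hyj))
  obtain ⟨y, hy⟩ := h.exists_right a p
  exact hi hd he (by grind) (h.sameBlock (key d hd (by grind) (by grind) (by grind) y hy)
    (key e he (by grind) (by grind) (by grind) y hy))

/-- If the blocks in colour `i` of three vertices are different and covered by two blocks, then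
each of the three meets both. -/
theorem exists_of_three_blocks (h : IsBlockColoring col) {i c d : Fin 5} {x u v w : α}
    (huv : ¬ SameBlock col i u v) (huw : ¬ SameBlock col i u w) (hvw : ¬ SameBlock col i v w)
    (hu : ∀ y, col u y = i → col x y = c ∨ col x y = d)
    (hv : ∀ y, col v y = i → col x y = c ∨ col x y = d)
    (hw : ∀ y, col w y = i → col x y = c ∨ col x y = d) : ∃ y, col u y = i ∧ col x y = c := by
  by_contra! hcon
  have hu' := h.anti_right fun y hy => (hu y hy).resolve_left (hcon y hy)
  have hv' := h.anti_right fun y hy =>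
    (hv y hy).resolve_right fun hd => huv (h.sameBlock (hu' y hd) hy)
  have hw' := h.anti_right fun y hy =>
    (hw y hy).resolve_right fun hd => huw (h.sameBlock (hu' y hd) hy)
  obtain ⟨y, hy⟩ := h.exists_right x c
  exact hvw (h.sameBlock (hv' y hy) (hw' y hy))

end IsBlockColoring

/-! ### Pentads: each of the two pairs shares both colours p and q -/

/-- Five vertices from different components of colour `i` with the same block in colour `j`,
together with a vertex of the other class joined to them in the remaining colours `p`, `q`, `r`
according to the pattern `p, p, q, q, r`. -/
structure IsPentad {α β : Type*} (col : α → β → Fin 5) (i j p q r : Fin 5) (a b c d e : α)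
    (y₀ : β) : Prop where
  coloring : IsBlockColoring col
  colors : [i, j, p, q, r].Nodup
  nodup : [a, b, c, d, e].Nodup
  same : ∀ u ∈ ({a, b, c, d, e} : Set α), ∀ v ∈ ({a, b, c, d, e} : Set α), SameBlock col j u v
  free : BlockFree col i {a, b, c, d, e}
  col_a : col a y₀ = p
  col_b : col b y₀ = p
  col_c : col c y₀ = q
  col_d : col d y₀ = q
  col_e : col e y₀ = r

namespace IsPentad

variable {α β : Type*} {col : α → β → Fin 5} {i j p q r : Fin 5} {a b c d e : α} {y₀ : β}

theorem swap_left (h : IsPentad col i j p q r a b c d e y₀) :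
    IsPentad col i j p q r b a c d e y₀ where
  coloring := h.coloring
  colors := h.colors
  nodup := by have := h.nodup; simp at this ⊢; grind
  same := by rw [Set.insert_comm]; exact h.same
  free := by rw [Set.insert_comm]; exact h.free
  col_a := h.col_b
  col_b := h.col_a
  col_c := h.col_c
  col_d := h.col_d
  col_e := h.col_e

theorem swap_pairs (h : IsPentad col i j p q r a b c d e y₀) :
    IsPentad col i j q p r c d a b e y₀ := by
  have hs : ({c, d, a, b, e} : Set α) = {a, b, c, d, e} := by
    ext x; simp only [Set.mem_insert_iff, Set.mem_singleton_iff]; tauto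
  exact
  { coloring := h.coloring
    colors := by
      have := h.colors
      simp only [List.nodup_cons, List.mem_cons, List.not_mem_nil, or_false, not_or] at this ⊢
      grind
    nodup := by
      have := h.nodup
      simp only [List.nodup_cons, List.mem_cons, List.not_mem_nil, or_false, not_or] at this ⊢
      grind
    same := by rw [hs]; exact h.same
    free := by rw [hs]; exact h.free
    col_a := h.col_c
    col_b := h.col_d
    col_c := h.col_a
    col_d := h.col_b
    col_e := h.col_e }

theorem swap_right (h : IsPentad col i j p q r a b c d e y₀) :
    IsPentad col i j p q r a b d c e y₀ :=
  h.swap_pairs.swap_left.swap_pairs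

theorem col_eq (h : IsPentad col i j p q r a b c d e y₀) {u v : α}
    (hu : u ∈ ({a, b, c, d, e} : Set α)) (hv : v ∈ ({a, b, c, d, e} : Set α)) (huv : u ≠ v)
    {y : β} (hy : col u y = i) : col v y = p ∨ col v y = q ∨ col v y = r := by
  have hij : i ≠ j := by
    have := h.colors
    simp only [List.nodup_cons, List.mem_cons, List.not_mem_nil, or_false, not_or] at this
    exact this.1.1
  rcases forall_color_of_nodup h.colors (col v y) with hc | hc | hc
  · exact (h.free hu hv huv (h.coloring.sameBlock hy hc)).elim
  · exact (hij (hy.symm.trans ((h.same u hu v hv y).2 hc))).elim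
  · exact hc

theorem not_triple (h : IsPentad col i j p q r a b c d e y₀) {t : Fin 5} (hti : t ≠ i)
    (htj : t ≠ j) {u v w : α} (hu : u ∈ ({a, b, c, d, e} : Set α))
    (hv : v ∈ ({a, b, c, d, e} : Set α)) (hw : w ∈ ({a, b, c, d, e} : Set α)) (huv : u ≠ v)
    (huw : u ≠ w) (hvw : v ≠ w) (h₁ : SameBlock col t u v) (h₂ : SameBlock col t u w) : False := by
  classical
  have hij : i ≠ j := by
    have := h.colors
    simp only [List.nodup_cons, List.mem_cons, List.not_mem_nil, or_false, not_or] at this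
    exact this.1.1
  have hcard : 1 < (([a, b, c, d, e].toFinset) \ {u, v, w}).card := by
    have h5 := List.toFinset_card_of_nodup h.nodup
    have h3 : ({u, v, w} : Finset α).card ≤ 3 := Finset.card_le_three
    have := Finset.le_card_sdiff ({u, v, w} : Finset α) [a, b, c, d, e].toFinset
    simp only [List.length_cons, List.length_nil] at h5
    omega
  obtain ⟨x, hx, x', hx', hxx⟩ := Finset.one_lt_card.1 hcard
  simp only [Finset.mem_sdiff, List.mem_toFinset, List.mem_cons, List.not_mem_nil, or_false,
    Finset.mem_insert, Finset.mem_singleton, not_or] at hx hx'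
  refine h.coloring.not_sameBlock_triple hij hti.symm htj.symm h.same h.free
    (a := u) (b := v) (c := w) (d := x) (e := x') ?_ hu hv hw ?_ ?_ h₁ h₂
  · simp only [List.nodup_cons, List.mem_cons, List.not_mem_nil, or_false, not_or]
    grind
  · simpa using hx.1
  · simpa using hx'.1

/-- A block is not properly contained in another one. -/
theorem exists_ne (h : IsPentad col i j p q r a b c d e y₀) {u v : α} {t : Fin 5} {y : β}
    (hv : col v y = t) (hu : col u y ≠ i) : ∃ z, col u z = i ∧ col v z ≠ t := by
  by_contra! hcon
  exact hu (h.coloring.anti_right hcon y hv)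

theorem pairwise_ne (h : IsPentad col i j p q r a b c d e y₀) :
    (p ≠ q ∧ p ≠ r ∧ q ≠ r) ∧ (p ≠ i ∧ q ≠ i ∧ r ≠ i) ∧ (p ≠ j ∧ q ≠ j ∧ r ≠ j) ∧
    (a ≠ b ∧ a ≠ c ∧ a ≠ d ∧ a ≠ e ∧ b ≠ c ∧ b ≠ d ∧ b ≠ e ∧ c ≠ d ∧ c ≠ e ∧ d ≠ e) := by
  have h₁ := h.colors
  have h₂ := h.nodup
  simp only [List.nodup_cons, List.mem_cons, List.not_mem_nil, or_false, not_or] at h₁ h₂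
  grind

/-- Otherwise Y_i[b] = Y_q[a], so on the i-blocks of `c`, `d`, `e` the vertices `a` and `b` have a
common colour, p or r. At a point of Y_i[e] where `c` avoids q, the pair `c`, `d` must take the
other of these two colours; both choices fail. -/
theorem not_sameBlock_left (h : IsPentad col i j p q r a b c d e y₀) : ¬ SameBlock col r a b := by
  intro hr
  obtain ⟨hpqr, hti, htj, hne⟩ := h.pairwise_ne
  have ma : a ∈ ({a, b, c, d, e} : Set α) := by simp
  have mb : b ∈ ({a, b, c, d, e} : Set α) := by simp
  have mc : c ∈ ({a, b, c, d, e} : Set α) := by simp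
  have md : d ∈ ({a, b, c, d, e} : Set α) := by simp
  have me : e ∈ ({a, b, c, d, e} : Set α) := by simp
  have hp := h.coloring.sameBlock h.col_a h.col_b
  have hq := h.coloring.sameBlock h.col_c h.col_d
  have same : ∀ {u v y t}, col u y = t → col v y = t → SameBlock col t u v :=
    fun h₁ h₂ => h.coloring.sameBlock h₁ h₂
  have hya := h.col_a
  have hyb := h.col_b
  have hyc := h.col_c
  have hyd := h.col_d
  have hye := h.col_e
  have hB : ∀ y, col b y = i → col a y = q := by
    intro y hy
    have := h.col_eq mb ma (by grind) hy
    have := hp y; have := hr y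
    grind
  have hA : ∀ y, col a y = i → col b y = q := by
    intro y hy
    have := h.col_eq ma mb (by grind) hy
    have := hp y; have := hr y
    grind
  have hB' := h.coloring.anti_right hB
  have hrow : ∀ u ∈ ({a, b, c, d, e} : Set α), u ≠ a → u ≠ b → ∀ y, col u y = i →
      (col a y = p ∧ col b y = p) ∨ (col a y = r ∧ col b y = r) := by
    intro u hu hua hub y hy
    have := h.col_eq hu ma hua hy
    have := h.col_eq hu mb hub hy
    have hb : col b y ≠ i := fun hb => h.free hu mb hub (same hy hb)
    have := hp y; have := hr y; have := hB' y
    grind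
  have hC : ∀ u v, u ∈ ({a, b, c, d, e} : Set α) → v ∈ ({a, b, c, d, e} : Set α) → u ≠ v →
      u ≠ a → u ≠ b → v ≠ a → v ≠ b → SameBlock col q u v →
      col u y₀ = q → ∃ y, col u y = i ∧ col a y = r ∧ col v y = p := by
    intro u v hu hv huv hua hub hva hvb huvq huq
    obtain ⟨y, hy, hy'⟩ := h.exists_ne (u := u) h.col_a (by grind)
    refine ⟨y, hy, ?_⟩
    have h₁ := hrow u hu hua hub y hy
    have h₂ := h.col_eq hu hv huv hy
    have h₃ := huvq y
    have h₄ : col v y = r → False := fun hv' => by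
      have hb : col b y = r := by grind
      have ha : col a y = r := by grind
      exact h.not_triple hti.2.2 htj.2.2 ma mb hv (by grind) (by grind) (by grind)
        (same ha hb) (same ha hv')
    grind
  obtain ⟨y₃, h₃, h₃a, h₃d⟩ := hC c d mc md (by grind) (by grind) (by grind) (by grind) (by grind)
    hq h.col_c
  obtain ⟨y₄, h₄, h₄a, h₄c⟩ := hC d c md mc (by grind) (by grind) (by grind) (by grind) (by grind)
    hq.symm h.col_d
  obtain ⟨y₅, h₅, h₅c⟩ := h.exists_ne (u := e) h.col_c (by grind)
  have hnt : ∀ t y, t ≠ i → t ≠ j → col a y = t → col b y = t → col c y ≠ t ∧ col d y ≠ t :=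
    fun t y h₁ h₂ ha hb => ⟨fun hc => h.not_triple h₁ h₂ ma mb mc (by grind) (by grind) (by grind)
      (same ha hb) (same ha hc), fun hc => h.not_triple h₁ h₂ ma mb md (by grind) (by grind)
      (by grind) (same ha hb) (same ha hc)⟩
  have e₁ := hrow e me (by grind) (by grind) y₅ h₅
  have e₂ := h.col_eq me mc (by grind) h₅
  have e₃ := h.col_eq me md (by grind) h₅
  have e₄ := hq y₅
  have e₅ := hnt p y₅ (by grind) (by grind)
  have e₆ := hnt r y₅ (by grind) (by grind)
  -- If `a`, `b` have p, then `c`, `d` share r, which forces Y_i[c] = Y_r[a], a set meeting Y_i[d]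
  -- in `y₄`. If they have r, then `c`, `d` share p, against the colours at `y₃`.
  rcases e₁ with e₁ | e₁
  · have hcd : SameBlock col r c d := same (y := y₅) (by grind) (by grind)
    have hc : ∀ y, col c y = i → col a y = r := by
      intro y hy
      have := hrow c mc (by grind) (by grind) y hy
      have := h.col_eq mc md (by grind) hy
      have := hcd y; have := hq y; have := hnt p y (by grind) (by grind)
      grind
    have := h.coloring.anti_right hc y₄ h₄a
    exact h.free mc md (by grind) (same this h₄)
  · have hcd : SameBlock col p c d := same (y := y₅) (by grind) (by grind)
    have := hcd y₃
    grind

theorem mems (_ : IsPentad col i j p q r a b c d e y₀) :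
    (a ∈ ({a, b, c, d, e} : Set α)) ∧ (b ∈ ({a, b, c, d, e} : Set α)) ∧
    (c ∈ ({a, b, c, d, e} : Set α)) ∧ (d ∈ ({a, b, c, d, e} : Set α)) ∧
    (e ∈ ({a, b, c, d, e} : Set α)) := by
  simp

theorem not_sameBlock_right (h : IsPentad col i j p q r a b c d e y₀) : ¬ SameBlock col r c d :=
  h.swap_pairs.not_sameBlock_left

/-- Here Y_i[c] = Y_q[b] and Y_i[d] = Y_r[b], while p is shared by `a` and `b`; no colour is left
for `b` on Y_i[a]. -/
theorem cross_pairs_false (h : IsPentad col i j p q r a b c d e y₀) (hcd : SameBlock col p c d)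
    (had : SameBlock col r d a) (hbc : SameBlock col r c b) : False := by
  obtain ⟨hpqr, hti, htj, hne⟩ := h.pairwise_ne
  obtain ⟨ma, mb, mc, md, me⟩ := h.mems
  have hp := h.coloring.sameBlock h.col_a h.col_b
  have hq := h.coloring.sameBlock h.col_c h.col_d
  have hr := h.not_sameBlock_left
  have same : ∀ {u v y t}, col u y = t → col v y = t → SameBlock col t u v :=
    fun h₁ h₂ => h.coloring.sameBlock h₁ h₂
  have hC : ∀ y, col c y = i → col b y = q := by
    intro y hy
    have := h.col_eq mc ma (by grind) hy
    have := h.col_eq mc mb (by grind) hy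
    have := h.col_eq mc md (by grind) hy
    have := hcd y; have := hq y; have := had y; have := hp y
    have : ¬ (col a y = r ∧ col b y = r) := fun hh => hr (same hh.1 hh.2)
    grind
  have hD : ∀ y, col d y = i → col b y = r := by
    intro y hy
    have := h.col_eq md mc (by grind) hy
    have := hcd y; have := hq y; have := hbc y
    grind
  have hC' := h.coloring.anti_right hC
  have hD' := h.coloring.anti_right hD
  obtain ⟨y, hy⟩ := h.coloring.exists_right a i
  have h₁ := h.col_eq ma mb (by grind) hy
  have h₂ := hp y
  have h₃ := hC' y
  have h₄ := hD' y
  have h₅ : col c y = i → False := fun hc => h.free ma mc (by grind) (same hy hc)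
  have h₆ : col d y = i → False := fun hc => h.free ma md (by grind) (same hy hc)
  grind

/-- If `c`, `d` shared p and q, a point of Y_i[c] where `a` avoids p would have colour r at `d` and
at one of `a`, `b`; likewise with `c` and `d` exchanged. Either `c` and `d` then share r, or
`cross_pairs_false` applies. -/
theorem not_sameBlock_first_right (h : IsPentad col i j p q r a b c d e y₀)
    (hab : ¬ SameBlock col q a b) : ¬ SameBlock col p c d := by
  intro hcd
  obtain ⟨hpqr, hti, htj, hne⟩ := h.pairwise_ne
  obtain ⟨ma, mb, mc, md, me⟩ := h.mems
  have hp := h.coloring.sameBlock h.col_a h.col_b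
  have hq := h.coloring.sameBlock h.col_c h.col_d
  have same : ∀ {u v y t}, col u y = t → col v y = t → SameBlock col t u v :=
    fun h₁ h₂ => h.coloring.sameBlock h₁ h₂
  have hya := h.col_a
  have key : ∀ u v, u ∈ ({a, b, c, d, e} : Set α) → v ∈ ({a, b, c, d, e} : Set α) → u ≠ v →
      u ≠ a → u ≠ b → SameBlock col q u v → SameBlock col p u v → col u y₀ = q →
      SameBlock col r v a ∨ SameBlock col r v b := by
    intro u v hu hv huv hua hub huvq huvp hy₀
    obtain ⟨y, hy, hy'⟩ := h.exists_ne (u := u) h.col_a (by grind)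
    have h₁ := h.col_eq hu hv huv hy
    have h₂ := h.col_eq hu ma hua hy
    have h₃ := h.col_eq hu mb hub hy
    have h₄ := huvq y
    have h₅ := huvp y
    have h₆ := hp y
    have h₇ : ¬ (col a y = q ∧ col b y = q) := fun hh => hab (same hh.1 hh.2)
    have hv : col v y = r := by grind
    have : col a y = r ∨ col b y = r := by grind
    exact this.imp (same hv) (same hv)
  have h₁ := key c d mc md (by grind) (by grind) (by grind) hq hcd h.col_c
  have h₂ := key d c md mc (by grind) (by grind) (by grind) hq.symm hcd.symm h.col_d
  have hr : ¬ SameBlock col r c d := h.not_sameBlock_right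
  rcases h₁ with h₁ | h₁ <;> rcases h₂ with h₂ | h₂
  · exact hr (h₂.trans h₁.symm)
  · exact h.cross_pairs_false hcd h₁ h₂
  · exact h.swap_left.cross_pairs_false hcd h₁ h₂
  · exact hr (h₂.trans h₁.symm)

/-- The configuration left when neither pair shares its second colour. Since `b` and `d` share r,
the colours of `a`, `b`, `c`, `d` at suitable points of Y_i[a] and Y_i[c] are determined, and the
fifth vertex `e` cannot be accommodated. -/
theorem split_false (h : IsPentad col i j p q r a b c d e y₀)
    (hab : ¬ SameBlock col q a b) (hcd : ¬ SameBlock col p c d) {y₅ : β}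
    (h₅a : col a y₅ = q) (h₅b : col b y₅ = r) (h₅c : col c y₅ = p) (h₅d : col d y₅ = r) :
    False := by
  obtain ⟨hpqr, hti, htj, hne⟩ := h.pairwise_ne
  obtain ⟨ma, mb, mc, md, me⟩ := h.mems
  have hp := h.coloring.sameBlock h.col_a h.col_b
  have hq := h.coloring.sameBlock h.col_c h.col_d
  have same : ∀ {u v y t}, col u y = t → col v y = t → SameBlock col t u v :=
    fun h₁ h₂ => h.coloring.sameBlock h₁ h₂
  have hbd := same h₅b h₅d
  have hya := h.col_a
  have hyc := h.col_c
  have nab : ∀ y, ¬ (col a y = q ∧ col b y = q) := fun y hh => hab (same hh.1 hh.2)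
  have ncd : ∀ y, ¬ (col c y = p ∧ col d y = p) := fun y hh => hcd (same hh.1 hh.2)
  have nbd : ∀ y, ¬ (col b y = p ∧ col d y = p) ∧ ¬ (col b y = q ∧ col d y = q) := by
    refine fun y => ⟨fun hh => ?_, fun hh => ?_⟩
    · exact h.not_triple (by grind) (by grind) mb ma md (by grind) (by grind) (by grind) hp.symm
        (same hh.1 hh.2)
    · exact h.not_triple (by grind) (by grind) md mc mb (by grind) (by grind) (by grind) hq.symm
        (same hh.2 hh.1)
  obtain ⟨y₁, h₁, h₁b⟩ := h.exists_ne (u := a) h₅b (by grind)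
  obtain ⟨y₃, h₃, h₃d⟩ := h.exists_ne (u := c) h₅d (by grind)
  have c₁ := h.col_eq ma mb (by grind) h₁
  have c₂ := h.col_eq ma mc (by grind) h₁
  have c₃ := h.col_eq ma md (by grind) h₁
  have c₄ := h.col_eq ma me (by grind) h₁
  have d₁ := h.col_eq mc ma (by grind) h₃
  have d₂ := h.col_eq mc mb (by grind) h₃
  have d₃ := h.col_eq mc md (by grind) h₃
  have d₄ := h.col_eq mc me (by grind) h₃
  have p₁ : col b y₁ = q ∧ col d y₁ = p ∧ col c y₁ = r := by
    have := hp y₁; have := hq y₁; have := hbd y₁; have := nbd y₁; have := ncd y₁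
    grind
  have p₃ : col d y₃ = p ∧ col b y₃ = q ∧ col a y₃ = r := by
    have := hp y₃; have := hq y₃; have := hbd y₃; have := nbd y₃; have := nab y₃
    grind
  have nr : ¬ (SameBlock col r a e ∧ SameBlock col r c e) := fun hh =>
    h.not_triple (by grind) (by grind) me ma mc (by grind) (by grind) (by grind)
      hh.1.symm hh.2.symm
  -- Otherwise `e` has colour r at both `y₁` and `y₃`, which puts `a`, `c`, `e` in one r-block.
  have hor : SameBlock col p d e ∨ SameBlock col q b e := by
    by_contra! hcon
    refine nr ⟨same (y := y₃) p₃.2.2 ?_, same (y := y₁) p₁.2.2 ?_⟩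
    · rcases d₄ with d₄ | d₄ | d₄
      · exact (hcon.1 (same p₃.1 d₄)).elim
      · exact (hcon.2 (same p₃.2.1 d₄)).elim
      · exact d₄
    · rcases c₄ with c₄ | c₄ | c₄
      · exact (hcon.1 (same p₁.2.1 c₄)).elim
      · exact (hcon.2 (same p₁.1 c₄)).elim
      · exact c₄
  rcases hor with hde | hbe
  · have e₁ : col e y₁ = p := (hde y₁).1 p₁.2.1
    have e₃ : col e y₃ = p := (hde y₃).1 p₃.1
    have n₁ : ∀ y, ¬ (col b y = q ∧ col e y = q) := fun y hh => by
      have := (same hh.1 hh.2) y₁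
      grind
    have n₂ : ∀ y, ¬ (col a y = r ∧ col e y = r) := fun y hh => by
      have := (same hh.1 hh.2) y₃
      grind
    obtain ⟨y, hy, hy'⟩ := h.exists_ne (u := d) h.col_a (by have := h.col_d; grind)
    have f₁ := h.col_eq md ma (by grind) hy
    have f₂ := h.col_eq md mb (by grind) hy
    have f₃ := h.col_eq md me (by grind) hy
    have := hp y; have := hbd y; have := nab y; have := hde y; have := n₁ y; have := n₂ y
    grind
  · have e₁ : col e y₁ = q := (hbe y₁).1 p₁.1
    have e₃ : col e y₃ = q := (hbe y₃).1 p₃.2.1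
    have n₁ : ∀ y, ¬ (col d y = p ∧ col e y = p) := fun y hh => by
      have := (same hh.1 hh.2) y₁
      grind
    have n₂ : ∀ y, ¬ (col c y = r ∧ col e y = r) := fun y hh => by
      have := (same hh.1 hh.2) y₁
      grind
    obtain ⟨y, hy, hy'⟩ := h.exists_ne (u := b) h.col_c (by have := h.col_b; grind)
    have f₁ := h.col_eq mb mc (by grind) hy
    have f₂ := h.col_eq mb md (by grind) hy
    have f₃ := h.col_eq mb me (by grind) hy
    have := hq y; have := hbd y; have := ncd y; have := hbe y; have := n₁ y; have := n₂ y
    grind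

/-- If not, then at a point of Y_i[e] where `a` avoids p, the vertices `a`, `b` take q, r and `c`,
`d` take p, r, each in some order; swapping within the pairs reduces to `split_false`. -/
theorem sameBlock_second_left (h : IsPentad col i j p q r a b c d e y₀) :
    SameBlock col q a b := by
  by_contra hab
  obtain ⟨hpqr, hti, htj, hne⟩ := h.pairwise_ne
  obtain ⟨ma, mb, mc, md, me⟩ := h.mems
  have hcd := h.not_sameBlock_first_right hab
  have hp := h.coloring.sameBlock h.col_a h.col_b
  have hq := h.coloring.sameBlock h.col_c h.col_d
  have same : ∀ {u v y t}, col u y = t → col v y = t → SameBlock col t u v :=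
    fun h₁ h₂ => h.coloring.sameBlock h₁ h₂
  have nab : ∀ y, ¬ (col a y = q ∧ col b y = q) ∧ ¬ (col a y = r ∧ col b y = r) :=
    fun y => ⟨fun hh => hab (same hh.1 hh.2), fun hh => h.not_sameBlock_left (same hh.1 hh.2)⟩
  have ncd : ∀ y, ¬ (col c y = p ∧ col d y = p) ∧ ¬ (col c y = r ∧ col d y = r) :=
    fun y => ⟨fun hh => hcd (same hh.1 hh.2), fun hh => h.not_sameBlock_right (same hh.1 hh.2)⟩
  have n₁ : ∀ u ∈ ({a, b, c, d, e} : Set α), u ≠ c → u ≠ d → ∀ y,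
      ¬ (col u y = q ∧ col c y = q) := fun u hu huc hud y hh =>
    h.not_triple (by grind) (by grind) mc md hu (by grind) (by grind) (by grind) hq
      (same hh.2 hh.1)
  obtain ⟨y, hy, hya⟩ := h.exists_ne (u := e) h.col_a (by have := h.col_e; grind)
  have f₁ := h.col_eq me ma (by grind) hy
  have f₂ := h.col_eq me mb (by grind) hy
  have f₃ := h.col_eq me mc (by grind) hy
  have f₄ := h.col_eq me md (by grind) hy
  have hl : (col a y = q ∧ col b y = r) ∨ (col b y = q ∧ col a y = r) := by
    have := hp y; have := nab y
    grind
  have hr : (col c y = p ∧ col d y = r) ∨ (col d y = p ∧ col c y = r) := by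
    have := hq y; have := ncd y; have := n₁ a ma (by grind) (by grind) y
    have := n₁ b mb (by grind) (by grind) y
    grind
  have hab' : ¬ SameBlock col q b a := fun hh => hab hh.symm
  have hcd' : ¬ SameBlock col p d c := fun hh => hcd hh.symm
  rcases hl with hl | hl <;> rcases hr with hr | hr
  · exact h.split_false hab hcd hl.1 hl.2 hr.1 hr.2
  · exact h.swap_right.split_false hab hcd' hl.1 hl.2 hr.1 hr.2
  · exact h.swap_left.split_false hab' hcd hl.1 hl.2 hr.1 hr.2
  · exact h.swap_left.swap_right.split_false hab' hcd' hl.1 hl.2 hr.1 hr.2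

theorem sameBlock_first_right (h : IsPentad col i j p q r a b c d e y₀) :
    SameBlock col p c d :=
  h.swap_pairs.sameBlock_second_left

end IsPentad

/-! ### Wide colours and the pairing pattern -/

/-- Colour `i` has at least nine components. -/
def IsWide {α β : Type*} (col : α → β → Fin 5) (i : Fin 5) : Prop :=
  ∃ u : Fin 9 → α, ∀ k l, k ≠ l → ¬ SameBlock col i (u k) (u l)

/-- Five indices, three values and no value taken three times: the fibres have sizes 2, 2, 1. This
supplies the pattern of a pentad. -/
theorem exists_pairing {ι γ : Type*} [Fintype ι] (hι : Fintype.card ι = 5) (f : ι → γ) {p q r : γ}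
    (hf : ∀ k, f k = p ∨ f k = q ∨ f k = r)
    (hf' : ∀ k l m, k ≠ l → k ≠ m → l ≠ m → f k = f l → f k ≠ f m) :
    ∃ k l m n o, [k, l, m, n, o].Nodup ∧ f k = f l ∧ f m = f n ∧ f k ≠ f m ∧ f k ≠ f o ∧
      f m ≠ f o := by
  classical
  have hle : ∀ t, (Finset.univ.filter fun k => f k = t).card ≤ 2 := by
    intro t
    by_contra! hcard
    obtain ⟨k, hk, l, hl, m, hm, hkl, hkm, hlm⟩ := Finset.two_lt_card.1 hcard
    simp only [Finset.mem_filter, Finset.mem_univ, true_and] at hk hl hm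
    exact hf' k l m hkl hkm hlm (hk.trans hl.symm) (hk.trans hm.symm)
  have key : ∀ p q r, p ≠ q → p ≠ r → q ≠ r → (Finset.univ.filter fun k => f k = p).card = 2 →
      (Finset.univ.filter fun k => f k = q).card = 2 →
      (Finset.univ.filter fun k => f k = r).card = 1 →
      ∃ k l m n o, [k, l, m, n, o].Nodup ∧ f k = f l ∧ f m = f n ∧ f k ≠ f m ∧ f k ≠ f o ∧
        f m ≠ f o := by
    intro p q r hpq hpr hqr hp hq hr
    obtain ⟨k, l, hkl, hp⟩ := Finset.card_eq_two.1 hp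
    obtain ⟨m, n, hmn, hq⟩ := Finset.card_eq_two.1 hq
    obtain ⟨o, hr⟩ := Finset.card_eq_one.1 hr
    simp only [Finset.ext_iff, Finset.mem_filter, Finset.mem_univ, true_and, Finset.mem_insert,
      Finset.mem_singleton] at hp hq hr
    have hk := (hp k).2 (Or.inl rfl)
    have hl := (hp l).2 (Or.inr rfl)
    have hm := (hq m).2 (Or.inl rfl)
    have hn := (hq n).2 (Or.inr rfl)
    have ho := (hr o).2 rfl
    refine ⟨k, l, m, n, o, ?_, by grind, by grind, by grind, by grind, by grind⟩
    simp only [List.nodup_cons, List.mem_cons, List.not_mem_nil, or_false, not_or]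
    grind
  have hunion : (Finset.univ : Finset ι) = (Finset.univ.filter fun k => f k = p) ∪
      ((Finset.univ.filter fun k => f k = q) ∪ (Finset.univ.filter fun k => f k = r)) := by
    ext k
    simpa using hf k
  have hsum := Finset.card_union_le (Finset.univ.filter fun k => f k = p)
    ((Finset.univ.filter fun k => f k = q) ∪ (Finset.univ.filter fun k => f k = r))
  have hsum' := Finset.card_union_le (Finset.univ.filter fun k => f k = q)
    (Finset.univ.filter fun k => f k = r)
  rw [← hunion, Finset.card_univ, hι] at hsum
  have hp := hle p
  have hq := hle q
  have hr := hle r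
  have hpq : p ≠ q := by
    rintro rfl
    rw [Finset.union_eq_right.2 Finset.subset_union_left] at hunion
    have h₁ : Fintype.card ι ≤ _ := (congrArg Finset.card hunion).trans_le hsum'
    omega
  have hpr : p ≠ r := by
    rintro rfl
    rw [Finset.union_eq_right.2 Finset.subset_union_right] at hunion
    have h₁ : Fintype.card ι ≤ _ := (congrArg Finset.card hunion).trans_le hsum'
    omega
  have hqr : q ≠ r := by
    rintro rfl
    rw [Finset.union_self] at hsum
    omega
  have hcases : (Finset.univ.filter fun k => f k = p).card = 1 ∨
      (Finset.univ.filter fun k => f k = q).card = 1 ∨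
      (Finset.univ.filter fun k => f k = r).card = 1 ∨
      ((Finset.univ.filter fun k => f k = p).card = 2 ∧
      (Finset.univ.filter fun k => f k = q).card = 2 ∧
      (Finset.univ.filter fun k => f k = r).card = 2) := by omega
  have hd : Disjoint (Finset.univ.filter fun k => f k = q) (Finset.univ.filter fun k => f k = r) :=
    Finset.disjoint_filter.2 fun k _ h₁ h₂ => hqr (h₁.symm.trans h₂)
  have hd' : Disjoint (Finset.univ.filter fun k => f k = p)
      ((Finset.univ.filter fun k => f k = q) ∪ (Finset.univ.filter fun k => f k = r)) :=
    Finset.disjoint_union_right.2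
      ⟨Finset.disjoint_filter.2 fun k _ h₁ h₂ => hpq (h₁.symm.trans h₂),
        Finset.disjoint_filter.2 fun k _ h₁ h₂ => hpr (h₁.symm.trans h₂)⟩
  have hex := congrArg Finset.card hunion
  rw [Finset.card_union_of_disjoint hd', Finset.card_union_of_disjoint hd, Finset.card_univ,
    hι] at hex
  rcases hcases with h₁ | h₁ | h₁ | h₁
  · exact key q r p hqr hpq.symm hpr.symm (by omega) (by omega) h₁
  · exact key p r q hpr hpq hqr.symm (by omega) (by omega) h₁
  · exact key p q r hpq hpr hqr (by omega) (by omega) h₁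
  · omega

theorem blockFree_of_pairwise {α β : Type*} {col : α → β → Fin 5} {i : Fin 5} {l : List α}
    (h : l.Pairwise fun a a' => ¬ SameBlock col i a a') :
    BlockFree col i {a | a ∈ l} ∧ l.Nodup := by
  have : Std.Symm fun a a' => ¬ SameBlock col i a a' := ⟨fun _ _ hn hs => hn hs.symm⟩
  refine ⟨fun a ha b hb hab => h.forall ha hb hab, h.imp ?_⟩
  rintro a _ hn rfl
  exact hn fun _ => Iff.rfl

/-! ### A pentad leaves no room for three more components -/

namespace IsPentad

variable {α β : Type*} {col : α → β → Fin 5} {i j p q r : Fin 5} {a b c d e : α} {y₀ : β}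

/-- Each outer i-block contains a point where (`a`, `c`) is coloured (p, q) or (q, p). Two of the
three points agree in pattern, and together with points of the i-blocks of `c`, `d`, `e` they
violate `not_sameBlock_triple` in the other class. -/
theorem false_of_three_more (h : IsPentad col i j p q r a b c d e y₀) {u v w : α}
    (huv : ¬ SameBlock col i u v) (huw : ¬ SameBlock col i u w) (hvw : ¬ SameBlock col i v w)
    (hu : ∀ x ∈ ({a, b, c, d, e} : Set α), ¬ SameBlock col i x u)
    (hv : ∀ x ∈ ({a, b, c, d, e} : Set α), ¬ SameBlock col i x v)
    (hw : ∀ x ∈ ({a, b, c, d, e} : Set α), ¬ SameBlock col i x w) : False := by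
  obtain ⟨hpqr, hti, htj, hne⟩ := h.pairwise_ne
  obtain ⟨ma, mb, mc, md, me⟩ := h.mems
  have pab := h.coloring.sameBlock h.col_a h.col_b
  have qab := h.sameBlock_second_left
  have qcd := h.coloring.sameBlock h.col_c h.col_d
  have pcd := h.sameBlock_first_right
  have same : ∀ {u v y t}, col u y = t → col v y = t → SameBlock col t u v :=
    fun h₁ h₂ => h.coloring.sameBlock h₁ h₂
  -- With p and q shared, `a` has only r on Y_i[b], so Y_i[b] = Y_r[a].
  have rb : ∀ y, col a y = r → col b y = i := by
    refine h.coloring.anti_right fun y hy => ?_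
    have := h.col_eq mb ma (by grind) hy; have := pab y; have := qab y
    grind
  have rd : ∀ y, col c y = r → col d y = i := by
    refine h.coloring.anti_right fun y hy => ?_
    have := h.col_eq md mc (by grind) hy; have := pcd y; have := qcd y
    grind
  have ntc : ∀ y, ¬ (col a y = p ∧ col c y = p) ∧ ¬ (col a y = q ∧ col c y = q) := fun y =>
    ⟨fun hh => h.not_triple (by grind) (by grind) ma mb mc (by grind) (by grind) (by grind) pab
      (same hh.1 hh.2), fun hh => h.not_triple (by grind) (by grind) ma mb mc (by grind)
      (by grind) (by grind) qab (same hh.1 hh.2)⟩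
  have nta : ∀ y, ¬ (col a y = p ∧ col e y = p) ∧ ¬ (col a y = q ∧ col e y = q) := fun y =>
    ⟨fun hh => h.not_triple (by grind) (by grind) ma mb me (by grind) (by grind) (by grind) pab
      (same hh.1 hh.2), fun hh => h.not_triple (by grind) (by grind) ma mb me (by grind)
      (by grind) (by grind) qab (same hh.1 hh.2)⟩
  have nte : ∀ y, ¬ (col c y = p ∧ col e y = p) ∧ ¬ (col c y = q ∧ col e y = q) := fun y =>
    ⟨fun hh => h.not_triple (by grind) (by grind) mc md me (by grind) (by grind) (by grind) pcd
      (same hh.1 hh.2), fun hh => h.not_triple (by grind) (by grind) mc md me (by grind)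
      (by grind) (by grind) qcd (same hh.1 hh.2)⟩
  have outer : ∀ x, (∀ z ∈ ({a, b, c, d, e} : Set α), ¬ SameBlock col i z x) → ∀ y, col x y = i →
      (∀ z ∈ ({a, b, c, d, e} : Set α), col z y ≠ i) := fun x hx y hy z hz hzy =>
    hx z hz (same hzy hy)
  have cols : ∀ y, (∀ z ∈ ({a, b, c, d, e} : Set α), col z y ≠ i) → col e y ≠ j →
      ((col a y = p ∧ col c y = q) ∨ (col a y = q ∧ col c y = p)) ∧ col e y = r := by
    intro y hy hj
    have := forall_color_of_nodup h.colors (col a y)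
    have := forall_color_of_nodup h.colors (col c y)
    have := forall_color_of_nodup h.colors (col e y)
    have := hy a ma; have := hy b mb; have := hy c mc; have := hy d md; have := hy e me
    have := h.same a ma e me y; have := h.same c mc e me y
    have := rb y; have := rd y; have := ntc y; have := nta y; have := nte y
    grind
  have rj : ∀ x, (∀ z ∈ ({a, b, c, d, e} : Set α), ¬ SameBlock col i z x) → ∀ y, col x y = i →
      col e y = r ∨ col e y = j := by
    intro x hx y hy
    by_cases hj : col e y = j
    · exact Or.inr hj
    · exact Or.inl (cols y (outer x hx y hy) hj).2
  -- The three outer i-blocks are covered by Y_r[e] and Y_j[e], so each contains a point of colour r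
  -- at `e`, where `cols` applies.
  obtain ⟨t₁, ht₁, et₁⟩ := h.coloring.exists_of_three_blocks huv huw hvw (rj u hu) (rj v hv)
    (rj w hw)
  obtain ⟨t₂, ht₂, et₂⟩ := h.coloring.exists_of_three_blocks (fun hs => huv hs.symm) hvw huw
    (rj v hv) (rj u hu) (rj w hw)
  obtain ⟨t₃, ht₃, et₃⟩ := h.coloring.exists_of_three_blocks (fun hs => huw hs.symm)
    (fun hs => hvw hs.symm) huv (rj w hw) (rj u hu) (rj v hv)
  have key : ∀ s s', (s = p ∧ s' = q) ∨ (s = q ∧ s' = p) → ∀ u v t t',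
      (∀ z ∈ ({a, b, c, d, e} : Set α), ¬ SameBlock col i z u) →
      (∀ z ∈ ({a, b, c, d, e} : Set α), ¬ SameBlock col i z v) → ¬ SameBlock col i u v →
      col u t = i → col v t' = i → col a t = s → col c t = s' → col a t' = s → col c t' = s' →
      False := by
    intro s s' hss u v t t' hu hv huv ht ht' hat hct hat' hct'
    have inner : ∀ x ∈ ({a, b, c, d, e} : Set α), x ≠ a → x ≠ b → ∀ y, col x y = i →
        col a y = s ∨ col a y = s' := by
      intro x hx hxa hxb y hy
      have := h.col_eq hx ma hxa hy; have := rb y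
      have : col b y ≠ i := fun hb => h.free hx mb hxb (same hy hb)
      grind
    have hcd := h.free mc md (by grind)
    have hce := h.free mc me (by grind)
    have hde := h.free md me (by grind)
    obtain ⟨y₃, hy₃, ay₃⟩ := h.coloring.exists_of_three_blocks hcd hce hde
      (inner c mc (by grind) (by grind)) (inner d md (by grind) (by grind))
      (inner e me (by grind) (by grind))
    obtain ⟨y₄, hy₄, ay₄⟩ := h.coloring.exists_of_three_blocks (fun hs => hcd hs.symm) hde hce
      (inner d md (by grind) (by grind)) (inner c mc (by grind) (by grind))
      (inner e me (by grind) (by grind))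
    obtain ⟨y₅, hy₅, ay₅⟩ := h.coloring.exists_of_three_blocks (fun hs => hce hs.symm)
      (fun hs => hde hs.symm) hcd
      (inner e me (by grind) (by grind)) (inner c mc (by grind) (by grind))
      (inner d md (by grind) (by grind))
    have cy₅ : col c y₅ = s' := by
      have := h.col_eq me mc (by grind) hy₅; have := rd y₅; have := ntc y₅
      have : col d y₅ ≠ i := fun hd => hde (same hd hy₅)
      grind
    have n : ∀ {x x' y y'}, ¬ SameBlock col i x x' → col x y = i → col x' y' = i →
        ¬ SameBlock (fun b a => col a b) i y y' := fun hn h₁ h₂ =>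
      IsBlockColoring.ne_of_sameBlock_swap hn h.coloring h₁ h₂
    have n₁ := n hcd hy₃ hy₄
    have n₂ := n hce hy₃ hy₅
    have n₃ := n (hu c mc) hy₃ ht
    have n₄ := n (hv c mc) hy₃ ht'
    have n₅ := n hde hy₄ hy₅
    have n₆ := n (hu d md) hy₄ ht
    have n₇ := n (hv d md) hy₄ ht'
    have n₈ := n (hu e me) hy₅ ht
    have n₉ := n (hv e me) hy₅ ht'
    have n₁₀ := n huv ht ht'
    obtain ⟨hfree, hnodup⟩ := blockFree_of_pairwise (col := fun b a => col a b) (i := i)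
      (l := [y₅, t, t', y₃, y₄]) (by
        simp only [List.pairwise_cons, List.mem_cons, List.not_mem_nil, or_false,
          forall_eq_or_imp, forall_eq, false_imp_iff, implies_true, List.Pairwise.nil, and_true]
        exact ⟨⟨n₈, n₉, fun hs => n₂ hs.symm, fun hs => n₅ hs.symm⟩,
          ⟨n₁₀, fun hs => n₃ hs.symm, fun hs => n₆ hs.symm⟩,
          ⟨fun hs => n₄ hs.symm, fun hs => n₇ hs.symm⟩, n₁⟩)
    have hall : ∀ y ∈ {y | y ∈ [y₅, t, t', y₃, y₄]}, col a y = s := by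
      simp only [Set.mem_ofPred_eq, List.mem_cons, List.not_mem_nil, or_false, forall_eq_or_imp,
        forall_eq]
      exact ⟨ay₅, hat, hat', ay₃, ay₄⟩
    exact h.coloring.swap.not_sameBlock_triple (i := i) (j := s) (p := s') (by grind) (by grind)
      (by grind) (fun y hy y' hy' => h.coloring.swap.sameBlock (hall y hy) (hall y' hy')) hfree
      hnodup (by simp) (by simp) (by simp) (by simp) (by simp)
      (h.coloring.swap.sameBlock cy₅ hct) (h.coloring.swap.sameBlock cy₅ hct')
  have c₁ := (cols t₁ (outer u hu t₁ ht₁) (by grind)).1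
  have c₂ := (cols t₂ (outer v hv t₂ ht₂) (by grind)).1
  have c₃ := (cols t₃ (outer w hw t₃ ht₃) (by grind)).1
  have k₁ := fun s s' hs => key s s' hs u v t₁ t₂ hu hv huv ht₁ ht₂
  have k₂ := fun s s' hs => key s s' hs u w t₁ t₃ hu hw huw ht₁ ht₃
  have k₃ := fun s s' hs => key s s' hs v w t₂ t₃ hv hw hvw ht₂ ht₃
  rcases c₁ with c₁ | c₁ <;> rcases c₂ with c₂ | c₂ <;> rcases c₃ with c₃ | c₃ <;> grind

end IsPentad

/-! ### Choosing representatives and counting colours -/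

theorem IsWide.exists_apply_eq {α β : Type*} {col : α → β → Fin 5} {i : Fin 5}
    (h : IsWide col i) (a : α) :
    ∃ u : Fin 9 → α, (∀ k l, k ≠ l → ¬ SameBlock col i (u k) (u l)) ∧ ∃ k, u k = a := by
  classical
  obtain ⟨u, hu⟩ := h
  have hex : ∃ k, ∀ l, l ≠ k → ¬ SameBlock col i a (u l) := by
    by_cases ha : ∃ k, SameBlock col i a (u k)
    · obtain ⟨k, hk⟩ := ha
      exact ⟨k, fun l hl hs => hu k l hl.symm (hk.symm.trans hs)⟩
    -- The component of `a` is not represented, so any index may be overwritten.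
    · exact ⟨0, fun l _ hs => ha ⟨l, hs⟩⟩
  obtain ⟨k, hk⟩ := hex
  refine ⟨Function.update u k a, fun l m hlm => ?_, k, Function.update_self ..⟩
  by_cases hl : l = k
  · subst hl
    rw [Function.update_self, Function.update_of_ne hlm.symm]
    exact hk m hlm.symm
  · rw [Function.update_of_ne hl]
    by_cases hm : m = k
    · subst hm
      rw [Function.update_self]
      exact fun hs => hk l hl hs.symm
    · rw [Function.update_of_ne hm]
      exact hu l m hlm

theorem IsWide.exists_three {α β : Type*} {col : α → β → Fin 5} {i : Fin 5}
    (h : IsWide col i) (x : Fin 5 → α) :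
    ∃ u v w, ¬ SameBlock col i u v ∧ ¬ SameBlock col i u w ∧ ¬ SameBlock col i v w ∧
      (∀ k, ¬ SameBlock col i (x k) u) ∧ (∀ k, ¬ SameBlock col i (x k) v) ∧
      ∀ k, ¬ SameBlock col i (x k) w := by
  classical
  obtain ⟨u, hu⟩ := h
  have hcard : (Finset.univ.filter fun l => ∃ k, SameBlock col i (x k) (u l)).card ≤ 5 := by
    have hex : ∀ l, ∃ k, (∃ k, SameBlock col i (x k) (u l)) → SameBlock col i (x k) (u l) := by
      intro l
      by_cases hl : ∃ k, SameBlock col i (x k) (u l)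
      · exact hl.imp fun k hk _ => hk
      · exact ⟨0, fun hl' => (hl hl').elim⟩
    choose f hf using hex
    refine (Finset.card_le_card_of_injOn f (t := Finset.univ) (fun _ _ => Finset.mem_univ _)
      ?_).trans_eq (Finset.card_fin 5)
    intro l hl m hm hlm
    by_contra hne
    have h₁ := hf l (by simpa using hl)
    have h₂ := hf m (by simpa using hm)
    replace hlm : f l = f m := hlm
    rw [hlm] at h₁
    exact hu l m hne (h₁.symm.trans h₂)
  have hcompl := Finset.card_filter_add_card_filter_not (s := (Finset.univ : Finset (Fin 9)))
    (fun l => ∃ k, SameBlock col i (x k) (u l))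
  rw [Finset.card_fin] at hcompl
  obtain ⟨k, hk, l, hl, m, hm, hkl, hkm, hlm⟩ := Finset.two_lt_card.1
    (show 2 < (Finset.univ.filter fun l => ¬ ∃ k, SameBlock col i (x k) (u l)).card by omega)
  simp only [Finset.mem_filter, Finset.mem_univ, true_and, not_exists] at hk hl hm
  exact ⟨u k, u l, u m, hu k l hkl, hu k m hkm, hu l m hlm, hk, hl, hm⟩

/-- A double count: eight nonempty sets in a set of four colours, each colour in at most four of
them, and the colours of the singletons in no other set. -/
theorem card_eq_of_profile {ι : Type*} {L : Finset ι} {C : ι → Finset (Fin 5)} {i : Fin 5}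
    (hL : 8 ≤ L.card) (hi : ∀ l ∈ L, i ∉ C l) (hne : ∀ l ∈ L, (C l).Nonempty)
    (hsingle : ∀ l ∈ L, ∀ m ∈ L, l ≠ m → ∀ c, C l = {c} → c ∉ C m)
    (hle : ∀ c, (L.filter fun l => c ∈ C l).card ≤ 4) :
    (∀ l ∈ L, (C l).card = 2) ∧ ∀ c, c ≠ i → (L.filter fun l => c ∈ C l).card = 4 := by
  classical
  set T := (Finset.univ : Finset (Fin 5)).erase i with hT
  have hTcard : T.card = 4 := by simp [hT]
  -- The weight 3 is affordable: a colour forming a singleton occurs only once, and 1 + 3 = 4.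
  -- Summed, this caps at 16 what the row estimate bounds below by 16 with weight 1, so there are no
  -- singletons.
  have hcol : ∀ c ∈ T, (L.filter fun l => c ∈ C l).card + 3 * (L.filter fun l => C l = {c}).card
      ≤ 4 := by
    intro c _
    rcases Nat.eq_zero_or_pos (L.filter fun l => C l = {c}).card with h0 | hpos
    · have := hle c
      omega
    · obtain ⟨l, hl⟩ := Finset.card_pos.1 hpos
      rw [Finset.mem_filter] at hl
      have h₁ : (L.filter fun l => c ∈ C l) ⊆ {l} := by
        intro m hm
        rw [Finset.mem_filter] at hm
        rw [Finset.mem_singleton]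
        by_contra hml
        exact hsingle l hl.1 m hm.1 (Ne.symm hml) c hl.2 hm.2
      have h₂ : (L.filter fun l => C l = {c}) ⊆ {l} := by
        refine subset_trans (fun m hm => ?_) h₁
        rw [Finset.mem_filter] at hm ⊢
        exact ⟨hm.1, by simp [hm.2]⟩
      have h₁ := Finset.card_le_card h₁
      have h₂ := Finset.card_le_card h₂
      rw [Finset.card_singleton] at h₁ h₂
      omega
  have hd₁ : ∑ l ∈ L, (C l).card = ∑ c ∈ T, (L.filter fun l => c ∈ C l).card := by
    refine Eq.trans (Finset.sum_congr rfl fun l hl => congrArg _ ?_)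
      (Finset.sum_card_bipartiteAbove_eq_sum_card_bipartiteBelow fun l c => c ∈ C l)
    ext c
    simp only [Finset.mem_bipartiteAbove, hT, Finset.mem_erase, Finset.mem_univ, and_true]
    exact ⟨fun hc => ⟨fun hci => hi l hl (hci ▸ hc), hc⟩, fun hc => hc.2⟩
  have hd₂ : ∑ l ∈ L, (T.filter fun c => C l = {c}).card =
      ∑ c ∈ T, (L.filter fun l => C l = {c}).card :=
    Finset.sum_card_bipartiteAbove_eq_sum_card_bipartiteBelow fun l c => C l = {c}
  have hrow : ∀ l ∈ L, 2 ≤ (C l).card + (T.filter fun c => C l = {c}).card := by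
    intro l hl
    have hpos := (hne l hl).card_pos
    by_cases h1 : (C l).card = 1
    · obtain ⟨c, hc⟩ := Finset.card_eq_one.1 h1
      have : 0 < (T.filter fun c => C l = {c}).card := by
        refine Finset.card_pos.2 ⟨c, Finset.mem_filter.2 ⟨Finset.mem_erase.2 ⟨?_, Finset.mem_univ _⟩,
          hc⟩⟩
        rintro rfl
        exact hi l hl (by simp [hc])
      omega
    · omega
  have hs₁ := Finset.sum_le_sum hrow
  have hs₂ := Finset.sum_le_sum hcol
  rw [Finset.sum_add_distrib, Finset.sum_const, smul_eq_mul, hd₁, hd₂] at hs₁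
  rw [Finset.sum_add_distrib, ← Finset.mul_sum, Finset.sum_const, smul_eq_mul, hTcard] at hs₂
  have hzero : ∑ c ∈ T, (L.filter fun l => C l = {c}).card = 0 := by omega
  have hrow' : ∀ l ∈ L, 2 ≤ (C l).card := by
    intro l hl
    have := hrow l hl
    rw [← hd₂, Finset.sum_eq_zero_iff] at hzero
    have := hzero l hl
    omega
  constructor
  · intro l hl
    by_contra hcard
    have hlt : ∑ l ∈ L, 2 < ∑ l ∈ L, (C l).card :=
      Finset.sum_lt_sum hrow' ⟨l, hl, by have := hrow' l hl; omega⟩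
    rw [Finset.sum_const, smul_eq_mul] at hlt
    omega
  · intro c hc
    by_contra hcard
    have hlt : ∑ c ∈ T, (L.filter fun l => c ∈ C l).card < ∑ c ∈ T, 4 :=
      Finset.sum_lt_sum (fun c _ => hle c) ⟨c, by simp [hT, hc], by have := hle c; omega⟩
    rw [Finset.sum_const, smul_eq_mul, hTcard] at hlt
    omega

/-! ### Two wide colours are contradictory -/

namespace IsBlockColoring

variable {α β : Type*} {col : α → β → Fin 5}

theorem isWide_swap (h : IsBlockColoring col) {i : Fin 5} (hw : IsWide col i) :
    IsWide (fun b a => col a b) i := by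
  obtain ⟨u, hu⟩ := hw
  choose v hv using fun k => h.exists_right (u k) i
  exact ⟨v, fun k l hkl => ne_of_sameBlock_swap (hu k l hkl) h (hv k) (hv l)⟩

/-- A block in a colour other than `i` meets at most four components of colour `i`. -/
theorem not_five_blocks (h : IsBlockColoring col) {i j : Fin 5} (hij : i ≠ j) (hw : IsWide col i)
    {x : Fin 5 → α} (hj : ∀ k l, SameBlock col j (x k) (x l))
    (hi : ∀ k l, k ≠ l → ¬ SameBlock col i (x k) (x l)) : False := by
  have hinj : Function.Injective x := by
    intro k l hkl
    by_contra hne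
    exact hi k l hne (hkl ▸ fun _ => Iff.rfl)
  obtain ⟨u, v, w, huv, huw, hvw, hu, hv, hw⟩ := hw.exists_three x
  -- Otherwise the outer i-blocks of `u` and `v` both lie in the common j-block, hence both equal
  -- it.
  have houter : ∃ y, (∀ k, col (x k) y ≠ i) ∧ ∀ k, col (x k) y ≠ j := by
    by_contra! hcon
    have hsub : ∀ u, (∀ k, ¬ SameBlock col i (x k) u) → ∀ y, col u y = i → col (x 0) y = j := by
      intro u hu y hy
      obtain ⟨k, hk⟩ := hcon y fun k hk => hu k (h.sameBlock hk hy)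
      exact (hj 0 k y).2 hk
    obtain ⟨y, hy⟩ := h.exists_right (x 0) j
    exact huv (h.sameBlock (h.anti_right (hsub u hu) y hy) (h.anti_right (hsub v hv) y hy))
  obtain ⟨y₀, hyi, hyj⟩ := houter
  have hsame : ∀ s ∈ Set.range x, ∀ t ∈ Set.range x, SameBlock col j s t := by
    rintro _ ⟨k, rfl⟩ _ ⟨l, rfl⟩
    exact hj k l
  have hfree : BlockFree col i (Set.range x) := by
    rintro _ ⟨k, rfl⟩ _ ⟨l, rfl⟩ hkl
    exact hi k l fun hkl' => hkl (congrArg x hkl')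
  have hcolor : ∃ p q r, [i, j, p, q, r].Nodup := by
    have : ∀ i j : Fin 5, i ≠ j → ∃ p q r, [i, j, p, q, r].Nodup := by decide
    exact this i j hij
  obtain ⟨p, q, r, hc⟩ := hcolor
  obtain ⟨k, l, m, n, o, hn, hkl, hmn, hkm, hko, hmo⟩ := exists_pairing (Fintype.card_fin 5)
    (fun k => col (x k) y₀) (p := p) (q := q) (r := r)
    (fun k => ((forall_color_of_nodup hc _).resolve_left (hyi k)).resolve_left (hyj k)) (by
      intro k l m hkl hkm hlm h₁ h₂
      have hrest : ∀ k l m : Fin 5, k ≠ l → k ≠ m → l ≠ m → ∃ n o, [k, l, m, n, o].Nodup :=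
        fun _ _ _ => exists_nodup_of_three
      obtain ⟨n, o, hn⟩ := hrest k l m hkl hkm hlm
      exact h.not_sameBlock_triple hij (hyi k).symm (hyj k).symm hsame hfree
        (hn.map hinj) ⟨k, rfl⟩ ⟨l, rfl⟩ ⟨m, rfl⟩ ⟨n, rfl⟩ ⟨o, rfl⟩ (h.sameBlock rfl h₁.symm)
        (h.sameBlock rfl h₂.symm))
  have hsub : ({x k, x l, x m, x n, x o} : Set α) ⊆ Set.range x := by
    simp [Set.insert_subset_iff]
  have hpent : IsPentad col i j (col (x k) y₀) (col (x m) y₀) (col (x o) y₀)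
      (x k) (x l) (x m) (x n) (x o) y₀ :=
    { coloring := h
      colors := by
        have := hyi k; have := hyi m; have := hyi o
        have := hyj k; have := hyj m; have := hyj o
        simp only [List.nodup_cons, List.mem_cons, List.not_mem_nil, or_false, not_or]
        grind
      nodup := hn.map hinj
      same := fun s hs t ht => hsame s (hsub hs) t (hsub ht)
      free := hfree.mono hsub
      col_a := rfl
      col_b := hkl.symm
      col_c := rfl
      col_d := hmn.symm
      col_e := rfl }
  have hmem : ∀ u, (∀ k, ¬ SameBlock col i (x k) u) →
      ∀ z ∈ ({x k, x l, x m, x n, x o} : Set α), ¬ SameBlock col i z u := by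
    intro u hu z hz
    obtain ⟨k, rfl⟩ := hsub hz
    exact hu k
  exact hpent.false_of_three_more huv huw hvw (hmem u hu) (hmem v hv) (hmem w hw)

-- The equality case of the count, applied to the colours that `x` has on the i-components avoiding
-- it; `not_five_blocks`, used in the other class, gives the bound four.
open Classical in
theorem profile (h : IsBlockColoring col) {i : Fin 5} (hw : IsWide col i) (x : α) {z : Fin 9 → β}
    (hz : ∀ k l, k ≠ l → ¬ SameBlock (fun b a => col a b) i (z k) (z l)) :
    (∀ l, col x (z l) ≠ i → (Finset.univ.filter fun c =>
      ∃ y, SameBlock (fun b a => col a b) i (z l) y ∧ col x y = c).card = 2) ∧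
    ∀ c, c ≠ i → ∃ y : Fin 4 → β, (∀ k, col x (y k) = c) ∧
      ∀ k l, k ≠ l → ¬ SameBlock (fun b a => col a b) i (y k) (y l) := by
  set C : Fin 9 → Finset (Fin 5) := fun l => Finset.univ.filter fun c =>
      ∃ y, SameBlock (fun b a => col a b) i (z l) y ∧ col x y = c with hC
  have memC : ∀ l c, c ∈ C l ↔ ∃ y, SameBlock (fun b a => col a b) i (z l) y ∧ col x y = c := by
    simp [hC]
  set L := Finset.univ.filter fun l => col x (z l) ≠ i with hLdef
  have memL : ∀ l, l ∈ L ↔ col x (z l) ≠ i := by simp [hLdef]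
  have hL : 8 ≤ L.card := by
    have hle : Lᶜ.card ≤ 1 := by
      refine Finset.card_le_one.2 fun l hl m hm => ?_
      rw [Finset.mem_compl, memL, not_not] at hl hm
      by_contra hlm
      exact hz l m hlm (h.swap.sameBlock hl hm)
    have := Finset.card_add_card_compl L
    rw [Fintype.card_fin] at this
    omega
  have hi : ∀ l ∈ L, i ∉ C l := by
    intro l hl hil
    obtain ⟨y, hy, hxy⟩ := (memC l i).1 hil
    exact (memL l).1 hl ((hy x).2 hxy)
  have hne : ∀ l ∈ L, (C l).Nonempty := fun l _ =>
    ⟨col x (z l), (memC l _).2 ⟨z l, fun _ => Iff.rfl, rfl⟩⟩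
  have hsingle : ∀ l ∈ L, ∀ m ∈ L, l ≠ m → ∀ c, C l = {c} → c ∉ C m := by
    intro l _ m _ hlm c hlc hcm
    obtain ⟨y, hy, hxy⟩ := (memC m c).1 hcm
    obtain ⟨a, ha⟩ := h.exists_left (z l) i
    have hsub : ∀ b, col a b = i → col x b = c := by
      intro b hb
      have := (memC l (col x b)).2 ⟨b, h.swap.sameBlock ha hb, rfl⟩
      simpa [hlc] using this
    have hay := h.anti_right hsub y hxy
    exact hz l m hlm (h.swap.sameBlock ha ((hy a).2 hay))
  have choice : ∀ c n, n ≤ (L.filter fun l => c ∈ C l).card → ∃ y : Fin n → β,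
      (∀ k, col x (y k) = c) ∧
      ∀ k l, k ≠ l → ¬ SameBlock (fun b a => col a b) i (y k) (y l) := by
    intro c n hn
    obtain ⟨s, hs, hcard⟩ := Finset.exists_subset_card_eq hn
    have hex : ∀ k : Fin n, ∃ y, SameBlock (fun b a => col a b) i
        (z (s.orderEmbOfFin hcard k)) y ∧ col x y = c := fun k =>
      (memC _ c).1 (Finset.mem_filter.1 (hs (s.orderEmbOfFin_mem hcard k))).2
    choose y hy hxy using hex
    refine ⟨y, hxy, fun k l hkl hs => ?_⟩
    exact hz _ _ (fun he => hkl ((s.orderEmbOfFin hcard).injective he))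
      (((hy k).trans hs).trans (hy l).symm)
  have hle : ∀ c, (L.filter fun l => c ∈ C l).card ≤ 4 := by
    intro c
    by_contra! hcard
    obtain ⟨y, hxy, hy⟩ := choice c 5 hcard
    have hic : i ≠ c := by
      rintro rfl
      exact hy 0 1 (by decide) (h.swap.sameBlock (hxy 0) (hxy 1))
    exact h.swap.not_five_blocks hic (h.isWide_swap hw)
      (fun k l => h.swap.sameBlock (hxy k) (hxy l)) hy
  obtain ⟨h₁, h₂⟩ := card_eq_of_profile hL hi hne hsingle hle
  exact ⟨fun l hl => h₁ l ((memL l).2 hl), fun c hc => choice c 4 (h₂ c hc).ge⟩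

open Classical in
theorem card_colors_eq_two (h : IsBlockColoring col) {i : Fin 5} (hw : IsWide col i) {x : α}
    {y : β} (hxy : col x y ≠ i) : (Finset.univ.filter fun c =>
      ∃ y', SameBlock (fun b a => col a b) i y y' ∧ col x y' = c).card = 2 := by
  obtain ⟨z, hz, k, rfl⟩ := (h.isWide_swap hw).exists_apply_eq y
  exact (h.profile hw x hz).1 k hxy

/-- Only colours 0 and 1 are played against each other. -/
theorem exists_not_isWide (h : IsBlockColoring col) [Nonempty β] : ∃ i, ¬ IsWide col i := by
  classical
  by_contra! hw
  obtain ⟨b⟩ := ‹Nonempty β›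
  obtain ⟨z, hz⟩ := hw 0
  obtain ⟨x, hxb, hx⟩ := (h.swap.profile (h.isWide_swap (hw 0)) b hz).2 1 (by decide)
  obtain ⟨y, hy⟩ := h.exists_right (x 0) 0
  have hcard := h.swap.card_colors_eq_two (h.isWide_swap (hw 1)) (x := y) (y := x 0) (i := 1)
    (by simp [hy])
  have hsame : ∀ k l, SameBlock col 1 (x k) (x l) := fun k l => h.sameBlock (hxb k) (hxb l)
  have hk : ∀ k, k ≠ 0 → col (x k) y ≠ 0 := fun k hk hk' =>
    hx k 0 hk (h.sameBlock hk' hy)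
  -- From `y` the common 1-block shows exactly two colours. One is 0, at `x 0`; the other three
  -- vertices avoid 0 and so share the second.
  have heq : ∀ k, k ≠ 0 → col (x k) y = col (x 1) y := by
    intro k hk0
    by_contra hne
    have hsub : ({0, col (x 1) y, col (x k) y} : Finset (Fin 5)) ⊆ Finset.univ.filter fun c =>
        ∃ y', SameBlock col 1 (x 0) y' ∧ col y' y = c := by
      intro c hc
      simp only [Finset.mem_insert, Finset.mem_singleton] at hc
      simp only [Finset.mem_filter, Finset.mem_univ, true_and]
      rcases hc with rfl | rfl | rfl
      · exact ⟨x 0, hsame 0 0, hy⟩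
      · exact ⟨x 1, hsame 0 1, rfl⟩
      · exact ⟨x k, hsame 0 k, rfl⟩
    have h3 := Finset.card_le_card hsub
    rw [hcard, Finset.card_eq_three.2 ⟨_, _, _, (hk 1 (by decide)).symm, (hk k hk0).symm,
      Ne.symm hne, rfl⟩] at h3
    omega
  have hne1 : col (x 1) y ≠ 1 := fun h1 => by
    have := (hsame 0 1 y).2 h1
    rw [hy] at this
    exact absurd this (by decide)
  -- The triple `x 1`, `x 2`, `x 3` shares two blocks, so `x 1` sees the 0-block of `x 0` in a
  -- single colour, where the profile demands two.
  have hB : ∀ y', col (x 0) y' = 0 → col (x 1) y' = col (x 1) y := by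
    intro y' hy'
    have hne : ∀ k, k ≠ 0 → col (x k) y' ≠ 0 := fun k hk hk' =>
      hx k 0 hk (h.sameBlock hk' hy')
    refine h.col_eq_of_triple (i := 0) (j := 1) (a := x 1) (b := x 2) (c := x 3) (by decide)
      (hk 1 (by decide)).symm hne1.symm (hsame 1 2) (hsame 1 3)
      (h.sameBlock rfl (heq 2 (by decide))) (h.sameBlock rfl (heq 3 (by decide)))
      (hx 1 2 (by decide)) (hx 1 3 (by decide)) (hx 2 3 (by decide)) ?_
      (hne 1 (by decide)) (hne 2 (by decide)) (hne 3 (by decide))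
    intro h1
    have := (hsame 0 1 y').2 h1
    rw [hy'] at this
    exact absurd this (by decide)
  have hcard' := h.card_colors_eq_two (hw 0) (hk 1 (by decide))
  have hsub : (Finset.univ.filter fun c =>
      ∃ y', SameBlock (fun b a => col a b) 0 y y' ∧ col (x 1) y' = c) ⊆ {col (x 1) y} := by
    intro c hc
    simp only [Finset.mem_filter, Finset.mem_univ, true_and] at hc
    obtain ⟨y', hs, rfl⟩ := hc
    exact Finset.mem_singleton.2 (hB y' ((hs (x 0)).1 hy))
  have := Finset.card_le_card hsub
  rw [hcard', Finset.card_singleton] at this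
  omega

end IsBlockColoring

/-! ### From graphs to colourings -/

variable {V : Type*} {G : SimpleGraph V} {X Y : Set V}

/-- The classes of a component are not given as its traces on `X` and `Y`. Still, `x` and `y` cannot
lie in the same class, since a common neighbour would belong to both `X` and `Y`. -/
theorem IsSpanningPartition.adj_of_reachable {r : ℕ} {H : Fin r → SimpleGraph V}
    (hG : IsBiclique G X Y) (hH : IsSpanningPartition G H) {i : Fin r} {x y : V} (hx : x ∈ X)
    (hy : y ∈ Y) (hxy : (H i).Reachable x y) : (H i).Adj x y := by
  set C := (H i).connectedComponentMk x with hC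
  have hxC : x ∈ C := rfl
  have hyC : y ∈ C := (SimpleGraph.ConnectedComponent.sound hxy).symm
  obtain ⟨A, B, hAB⟩ := hH.biEquivalence i C (by rw [hH.spanning i]; exact Set.subset_univ _)
  have hdisj := hG.bipartite.disjoint
  have hside : ∀ {A B : Set C}, IsBiclique C.toSimpleGraph A B → (⟨x, hxC⟩ : C) ∈ A →
      (H i).Adj x y := by
    intro A B hAB hxA
    have hyAB : (⟨y, hyC⟩ : C) ∈ A ∪ B := hAB.union_eq ▸ Set.mem_univ _
    rcases hyAB with hyA | hyB
    · exfalso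
      obtain ⟨⟨z, hzC⟩, hzB⟩ := hAB.nonempty_right
      have h₁ : (H i).Adj x z := (C.toSimpleGraph_adj hxC hzC).1 (hAB.complete hxA hzB)
      have h₂ : (H i).Adj y z := (C.toSimpleGraph_adj hyC hzC).1 (hAB.complete hyA hzB)
      rcases hG.bipartite.mem_of_adj (hH.le i h₁) with h₁ | h₁
      · rcases hG.bipartite.mem_of_adj (hH.le i h₂) with h₂ | h₂
        · exact Set.disjoint_left.1 hdisj h₂.1 hy
        · exact Set.disjoint_left.1 hdisj h₂.2 h₁.2
      · exact Set.disjoint_left.1 hdisj hx h₁.1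
    · exact (C.toSimpleGraph_adj hxC hyC).1 (hAB.complete hxA hyB)
  have hxAB : (⟨x, hxC⟩ : C) ∈ A ∪ B := hAB.union_eq ▸ Set.mem_univ _
  rcases hxAB with hxA | hxB
  · exact hside hAB hxA
  · refine hside (A := B) (B := A) ?_ hxB
    exact ⟨hAB.nonempty_right, hAB.nonempty_left, (Set.union_comm _ _).trans hAB.union_eq,
      hAB.bipartite.symm, fun _ h₁ _ h₂ => (hAB.complete h₂ h₁).symm⟩

theorem IsAntichainPartition.exists_isBlockColoring (hG : IsBiclique G X Y)
    {H : Fin 5 → SimpleGraph V} (hH : IsAntichainPartition G X Y H) :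
    ∃ col : X → Y → Fin 5, IsBlockColoring col ∧ ∀ x y i, col x y = i ↔ (H i).Reachable x y := by
  have hadj := fun {i x y} => hH.toIsSpanningPartition.adj_of_reachable hG (i := i) (x := x) (y := y)
  choose col hcol huniq using fun (x : X) (y : Y) =>
    hH.existsUnique_color x y (hG.complete x.2 y.2)
  have hiff : ∀ x y i, col x y = i ↔ (H i).Reachable x y := fun x y i =>
    ⟨fun h => h ▸ (hcol x y).reachable, fun h => (huniq x y i (hadj x.2 y.2 h)).symm⟩
  have hright : ∀ x i, ∃ y, col x y = i := by
    intro x i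
    obtain ⟨z, hz⟩ := (H i).mem_support.1 (hH.spanning i ▸ Set.mem_univ (x : V))
    rcases hG.bipartite.mem_of_adj (hH.le i hz) with h | h
    · exact ⟨⟨z, h.2⟩, (hiff _ _ _).2 hz.reachable⟩
    · exact (Set.disjoint_left.1 hG.bipartite.disjoint x.2 h.1).elim
  have hleft : ∀ y i, ∃ x, col x y = i := by
    intro y i
    obtain ⟨z, hz⟩ := (H i).mem_support.1 (hH.spanning i ▸ Set.mem_univ (y : V))
    rcases hG.bipartite.mem_of_adj (hH.le i hz) with h | h
    · exact (Set.disjoint_left.1 hG.bipartite.disjoint h.1 y.2).elim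
    · exact ⟨⟨z, h.2⟩, (hiff _ _ _).2 hz.reachable.symm⟩
  have hblockX : ∀ (x : X) (y : Y) i, (x : V) ∈ block X (H i) y ↔ col x y = i := fun x y i => by
    simp [block, hiff, SimpleGraph.ConnectedComponent.eq]
  have hblockY : ∀ (x : X) (y : Y) i, (y : V) ∈ block Y (H i) x ↔ col x y = i := fun x y i => by
    simp [block, hiff, SimpleGraph.ConnectedComponent.eq, SimpleGraph.reachable_comm]
  refine ⟨col, ⟨?_, hright, fun y i => hleft y i, ?_, ?_⟩, hiff⟩
  · intro a a' b b' i h₁ h₂ h₃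
    rw [hiff] at h₁ h₂ h₃ ⊢
    exact h₁.trans (h₂.symm.trans h₃)
  · intro a a' i j hsub b hb
    by_contra hne
    refine hH.antichain_right i j a a' ⟨fun z hz => ?_, fun hsub' => ?_⟩
    · exact (hblockY a' ⟨z, hz.1⟩ j).2 (hsub _ ((hblockY a ⟨z, hz.1⟩ i).1 hz))
    · exact hne ((hblockY a b i).1 (hsub' ((hblockY a' b j).2 hb)))
  · intro b b' i j hsub a ha
    by_contra hne
    refine hH.antichain_left i j b b' ⟨fun z hz => ?_, fun hsub' => ?_⟩
    · exact (hblockX ⟨z, hz.1⟩ b' j).2 (hsub _ ((hblockX ⟨z, hz.1⟩ b i).1 hz))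
    · exact hne ((hblockX a b i).1 (hsub' ((hblockX a b' j).2 ha)))

theorem exists_embedding_of_lt_card {α : Type*} {n : ℕ} (h : (n : ℕ∞) < ENat.card α) :
    Nonempty (Fin (n + 1) ↪ α) := by
  rcases finite_or_infinite α with hα | hα
  · have := Fintype.ofFinite α
    rw [ENat.card_eq_coe_fintype_card, Nat.cast_lt] at h
    exact Function.Embedding.nonempty_of_card_le (by simpa using h)
  · exact ⟨Fin.valEmbedding.trans (Infinite.natEmbedding α)⟩

end BicliquePartition

theorem theorem5p1 {V : Type*} (G : SimpleGraph V) (X Y : Set V)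
    (hG : BicliquePartition.IsBiclique G X Y) (H : Fin 5 → SimpleGraph V)
    (hH : BicliquePartition.IsAntichainPartition G X Y H) :
    ∃ i : Fin 5, BicliquePartition.width (H i) ≤ 8 := by
  obtain ⟨col, hcol, hiff⟩ := hH.exists_isBlockColoring hG
  have := hG.nonempty_right.to_subtype
  obtain ⟨i, hi⟩ := hcol.exists_not_isWide
  refine ⟨i, not_lt.1 fun hlt => hi ?_⟩
  obtain ⟨f⟩ := BicliquePartition.exists_embedding_of_lt_card (n := 8) hlt
  -- Wideness is tested by vertices of `X` only, and by the spanning condition every component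
  -- contains one.
  have hex : ∀ C : (H i).ConnectedComponent, ∃ x : X, (H i).connectedComponentMk x = C := by
    intro C
    induction C using SimpleGraph.ConnectedComponent.ind with
    | _ v =>
      have hv : v ∈ X ∪ Y := hG.union_eq ▸ Set.mem_univ v
      rcases hv with hv | hv
      · exact ⟨⟨v, hv⟩, rfl⟩
      · obtain ⟨x, hx⟩ := hcol.exists_left ⟨v, hv⟩ i
        exact ⟨x, SimpleGraph.ConnectedComponent.sound ((hiff _ _ _).1 hx)⟩
  choose u hu using fun k => hex (f k)
  refine ⟨u, fun k l hkl hs => hkl (f.injective ?_)⟩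
  obtain ⟨y, hy⟩ := hcol.exists_right (u k) i
  rw [← hu k, ← hu l]
  exact SimpleGraph.ConnectedComponent.sound
    (((hiff _ _ _).1 hy).trans ((hiff _ _ _).1 ((hs y).1 hy)).symm)
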